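/- For positive integers $i_1,\dots,i_k$ with $i_1>1$, let $\zeta(i_1,\dots,i_k)=\sum_{n_1>\dots>n_k\ge 1}\frac{1}{n_1^{i_1}\cdots n_k^{i_k}}$ be the multiple zeta value of weight $i_1+\dots+i_k$ and depth $k$. For $1\le k\le n$ let $$E(2n,k)=\sum_{\substack{i_1,\dots,i_k \text{ even positive integers}\\ i_1+\dots+i_k=2n}}\zeta(i_1,\dots,i_k)$$ (all the series that occur converge). Then for all $n\ge 1$, $$\sum_{k=1}^n E(2n,k)=\frac{2(2^{2n-1}-1)(-1)^{n-1}B_{2n}\,\pi^{2n}}{(2n)!},$$ where $B_{2n}$ is the $2n$-th Bernoulli number. Moreover, $$\frac{\pi\sqrt t}{\sin(\pi\sqrt t)}=1+\sum_{n\ge 1}\Big(\sum_{k=1}^n E(2n,k)\Big)t^n$$ for all complex $t$ near $0$ (the left side being given its limit value $1$ at $t=0$); that is, for every $n\ge1$ the sum of all multiple zeta values of weight $2n$ with even arguments is the coefficient of $t^n$ in the power series expansion of $\pi\sqrt t/\sin(\pi\sqrt t)$ at $t=0$. -/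

import Mathlib

open scoped BigOperators Nat

noncomputable section

/-- Index set of the multiple zeta series of depth `k`: the `k`-tuples of integers
`m 0 > m 1 > ⋯ > m (k - 1) ≥ 1`. -/
def MZVIndex (k : ℕ) : Type :=
  {m : Fin k → ℕ // StrictAnti m ∧ ∀ j, 1 ≤ m j}

/-- The general term `1 / (m₁ ^ i₁ ⋯ m_k ^ i_k)` of the multiple zeta series. -/
def mzvTerm {k : ℕ} (i : Fin k → ℕ) (m : MZVIndex k) : ℝ :=
  1 / ∏ j, (m.1 j : ℝ) ^ i j

/-- The multiple zeta value `ζ(i₁, …, i_k)`. -/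
def multipleZetaValue {k : ℕ} (i : Fin k → ℕ) : ℝ :=
  ∑' m : MZVIndex k, mzvTerm i m

/-- All sequences `(i₁, …, i_k)` of positive even integers with `i₁ + ⋯ + i_k = w`. -/
def evenArguments (w k : ℕ) : Finset (Fin k → ℕ) :=
  (Finset.piAntidiag (Finset.univ : Finset (Fin k)) w).filter fun i => ∀ j, 0 < i j ∧ Even (i j)

/-- `evenMZVSum w k` is `E(w, k)`: the sum of all multiple zeta values with even arguments,
weight `w` and depth `k`. -/
def evenMZVSum (w k : ℕ) : ℝ :=
  ∑ i ∈ evenArguments w k, multipleZetaValue i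

/-- The function `π √t / sin (π √t)` of a complex variable `t`, with its removable singularity at
`t = 0` filled in. It does not depend on the branch of the square root. -/
def piSqrtDivSin (t : ℂ) : ℂ :=
  if t = 0 then 1
  else (Real.pi : ℂ) * t ^ (1 / 2 : ℂ) / Complex.sin ((Real.pi : ℂ) * t ^ (1 / 2 : ℂ))

end

open Filter Topology

/-! Expand `∏ (1 - t/m²)⁻¹ = ∏ (1 + ∑_{a ≥ 1} tᵃ/m²ᵃ)` over `m ≥ 1`. Choosing the finite set of `m`
whose factor is not `1` produces each term of each even-argument multiple zeta value once, so the
coefficient of `tⁿ` is `∑ E(2n,k)`; Euler's sine product identifies the whole with `π√t / sin(π√t)`.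
Rigorously, the partial products converge coefficientwise (`tendsto_coeff_prod_invSqGeom`), and a
bound `C * 4 ^ n` uniform in `N` lets the limit pass through the power series when `‖t‖ < 1/4`. For
the closed form put `t = z²`: the generating series and the rescaled `2B(X) - B(2X)` have the same
product with `e^{πiX} - e^{-πiX}`, which cancels. -/

/-- The power series `∑_{a ≥ 1} (m⁻²)ᵃ Xᵃ`. -/
noncomputable def invSqGeomTail (m : ℕ) : PowerSeries ℝ :=
  PowerSeries.mk fun a => if a = 0 then 0 else (((m : ℝ) ^ 2)⁻¹) ^ a

/-- The power series `∑_{a ≥ 0} (m⁻²)ᵃ Xᵃ`. -/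
noncomputable def invSqGeom (m : ℕ) : PowerSeries ℝ :=
  PowerSeries.mk fun a => (((m : ℝ) ^ 2)⁻¹) ^ a

theorem invSqGeom_eq_one_add (m : ℕ) : invSqGeom m = 1 + invSqGeomTail m := by
  ext a
  rcases eq_or_ne a 0 with rfl | ha <;> simp [invSqGeom, invSqGeomTail, PowerSeries.coeff_one, *]

/-- By the convention `0⁻¹ = 0`, the index `m = 0` is harmless in products over `Finset.range N`. -/
theorem invSqGeomTail_zero : invSqGeomTail 0 = 0 := by
  ext a
  simp [invSqGeomTail]

/-! ### Multiple zeta sums as coefficients of products -/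

theorem mem_evenArguments {w k : ℕ} {i : Fin k → ℕ} :
    i ∈ evenArguments w k ↔ ∑ j, i j = w ∧ ∀ j, 0 < i j ∧ Even (i j) := by
  simp [evenArguments]

theorem coeff_prod_invSqGeomTail_fin (n : ℕ) {k : ℕ} (m : Fin k → ℕ) :
    PowerSeries.coeff n (∏ j, invSqGeomTail (m j)) =
      ∑ i ∈ evenArguments (2 * n) k, 1 / ∏ j, (m j : ℝ) ^ i j := by
  rw [PowerSeries.coeff_prod]
  symm
  -- Halve the exponents. Tuples missed by this map have a zero entry and contribute nothing, the
  -- tail having no constant term.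
  refine Finset.sum_of_injOn (fun i => Finsupp.equivFunOnFinite.symm fun j => i j / 2) ?_ ?_ ?_ ?_
  · intro i hi i' hi' h
    have hi := (mem_evenArguments.1 hi).2
    have hi' := (mem_evenArguments.1 hi').2
    have h := Finsupp.equivFunOnFinite.symm.injective h
    funext j
    have h1 := (hi j).2.two_dvd
    have h2 := (hi' j).2.two_dvd
    have h3 : i j / 2 = i' j / 2 := congrFun h j
    omega
  · intro i hi
    obtain ⟨hs, hi⟩ := mem_evenArguments.1 hi
    simp only [Finset.mem_coe, Finset.mem_finsuppAntidiag, Finset.subset_univ, and_true]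
    have : ∑ j, 2 * (i j / 2) = 2 * n := by
      rw [← hs]
      exact Finset.sum_congr rfl fun j _ => Nat.mul_div_cancel' (hi j).2.two_dvd
    rw [← Finset.mul_sum] at this
    simpa using this
  · intro l hl hni
    have hl := (Finset.mem_finsuppAntidiag.1 hl).1
    by_contra hne
    refine hni ⟨fun j => 2 * l j, mem_evenArguments.2 ⟨by rw [← Finset.mul_sum, hl], fun j => ?_⟩,
      by ext j; simp⟩
    have := (Finset.prod_ne_zero_iff.1 hne) j (Finset.mem_univ j)
    have hj : l j ≠ 0 := by
      intro h0
      simp [invSqGeomTail, h0] at this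
    exact ⟨by omega, even_two_mul _⟩
  · intro i hi
    have hi := (mem_evenArguments.1 hi).2
    rw [one_div, ← Finset.prod_inv_distrib]
    refine Finset.prod_congr rfl fun j _ => ?_
    obtain ⟨h0, a, ha⟩ := hi j
    have ha0 : a ≠ 0 := by omega
    simp [invSqGeomTail, ha0, ha, ← two_mul, pow_mul]

/-- The set of entries of an index of the multiple zeta series. -/
def MZVIndex.toFinset {k : ℕ} (m : MZVIndex k) : Finset ℕ := Finset.univ.map ⟨m.1, m.2.1.injective⟩

theorem MZVIndex.card_toFinset {k : ℕ} (m : MZVIndex k) : m.toFinset.card = k := by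
  simp [MZVIndex.toFinset]

theorem MZVIndex.mem_toFinset {k : ℕ} (m : MZVIndex k) (j : Fin k) : m.1 j ∈ m.toFinset := by
  simp [MZVIndex.toFinset]

theorem MZVIndex.toFinset_injective (k : ℕ) :
    Function.Injective (MZVIndex.toFinset : MZVIndex k → Finset ℕ) := by
  have key (m : MZVIndex k) (S : Finset ℕ) (hS : S.card = k) (h : m.toFinset = S) :
      m.1 ∘ Fin.rev = S.orderEmbOfFin hS :=
    Finset.orderEmbOfFin_unique hS (fun j => h ▸ m.mem_toFinset _)
      fun a b hab => m.2.1 (Fin.rev_lt_rev.2 hab)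
  intro m m' h
  have := (key m _ m'.card_toFinset h).trans (key m' _ m'.card_toFinset rfl).symm
  refine Subtype.ext (funext fun j => ?_)
  simpa using congrFun this j.rev

theorem MZVIndex.mem_range_toFinset {k : ℕ} {S : Finset ℕ} :
    S ∈ Set.range (MZVIndex.toFinset : MZVIndex k → Finset ℕ) ↔ S.card = k ∧ 0 ∉ S := by
  constructor
  · rintro ⟨m, rfl⟩
    refine ⟨m.card_toFinset, fun h => ?_⟩
    obtain ⟨j, -, hj⟩ := Finset.mem_map.1 h
    have := m.2.2 j
    simp only [Function.Embedding.coeFn_mk] at hj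
    omega
  · rintro ⟨hS, h0⟩
    refine ⟨⟨S.orderEmbOfFin hS ∘ Fin.rev, fun a b hab => (S.orderEmbOfFin hS).strictMono
      (Fin.rev_lt_rev.2 hab), fun j => Nat.one_le_iff_ne_zero.2 fun h =>
        h0 (h ▸ S.orderEmbOfFin_mem hS _)⟩, ?_⟩
    apply Finset.eq_of_subset_of_card_le
    · intro x hx
      obtain ⟨j, -, rfl⟩ := Finset.mem_map.1 hx
      exact S.orderEmbOfFin_mem hS _
    · exact hS.le.trans (MZVIndex.card_toFinset _).ge

theorem summable_mzvTerm {w k : ℕ} {i : Fin k → ℕ} (hi : i ∈ evenArguments w k) :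
    Summable (mzvTerm i) := by
  have hsum : Summable fun m : ℕ => ((m : ℝ) ^ 2)⁻¹ := by
    exact Real.summable_nat_pow_inv.2 one_lt_two
  have h1 := (summable_finsetProd_of_summable_nonneg (fun m => by positivity) hsum).comp_injective
    (MZVIndex.toFinset_injective k)
  -- Positive even exponents are at least `2`, so the term is at most the product of the `m⁻²`.
  refine h1.of_nonneg_of_le (fun m => by unfold mzvTerm; positivity) fun m => ?_
  simp only [mzvTerm, MZVIndex.toFinset, Function.comp_apply, Finset.prod_map,
    Function.Embedding.coeFn_mk, one_div, ← Finset.prod_inv_distrib]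
  refine Finset.prod_le_prod (fun j _ => by positivity) fun j _ => ?_
  have hm : (1 : ℝ) ≤ m.1 j := by exact_mod_cast m.2.2 j
  obtain ⟨h0, a, ha⟩ := (mem_evenArguments.1 hi).2 j
  have h2 : 2 ≤ i j := by omega
  gcongr

theorem hasSum_mzvTerm_evenMZVSum (n k : ℕ) :
    HasSum (fun m : MZVIndex k => PowerSeries.coeff n (∏ x ∈ m.toFinset, invSqGeomTail x))
      (evenMZVSum (2 * n) k) := by
  have h : ∀ m : MZVIndex k, PowerSeries.coeff n (∏ x ∈ m.toFinset, invSqGeomTail x) =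
      ∑ i ∈ evenArguments (2 * n) k, mzvTerm i m := fun m => by
    simp only [MZVIndex.toFinset, Finset.prod_map, Function.Embedding.coeFn_mk,
      coeff_prod_invSqGeomTail_fin, mzvTerm]
  simp only [h]
  exact hasSum_sum fun i hi => (summable_mzvTerm hi).hasSum

theorem coeff_prod_invSqGeomTail_eq_zero {n : ℕ} {S : Finset ℕ} (h : n < S.card) :
    PowerSeries.coeff n (∏ x ∈ S, invSqGeomTail x) = 0 := by
  have : (PowerSeries.X : PowerSeries ℝ) ^ S.card ∣ ∏ x ∈ S, invSqGeomTail x := by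
    rw [← Finset.prod_const]
    exact Finset.prod_dvd_prod_of_dvd _ _ fun x _ =>
      PowerSeries.X_dvd_iff.2 (by simp [invSqGeomTail])
  exact PowerSeries.X_pow_dvd_iff.1 this n h

/-- Sort finite sets by cardinality, which is the depth. Sets containing `0`, the empty set and sets
with more than `n` elements contribute zero. -/
theorem hasSum_coeff_prod_invSqGeomTail {n : ℕ} (hn : n ≠ 0) :
    HasSum (fun S : Finset ℕ => PowerSeries.coeff n (∏ x ∈ S, invSqGeomTail x))
      (∑ k ∈ Finset.Icc 1 n, evenMZVSum (2 * n) k) := by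
  have h (k : ℕ) : HasSum (fun S : Finset ℕ =>
      if S.card = k then PowerSeries.coeff n (∏ x ∈ S, invSqGeomTail x) else 0)
      (evenMZVSum (2 * n) k) := by
    refine ((MZVIndex.toFinset_injective k).hasSum_iff fun S hS => ?_).1 ?_
    · rw [MZVIndex.mem_range_toFinset] at hS
      split_ifs with hk
      · have h0 : 0 ∈ S := by tauto
        rw [Finset.prod_eq_zero h0 invSqGeomTail_zero, map_zero]
      · rfl
    · convert hasSum_mzvTerm_evenMZVSum n k using 2 with m
      simp [MZVIndex.card_toFinset]
  convert hasSum_sum fun k (_ : k ∈ Finset.Icc 1 n) => h k using 2 with S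
  rw [Finset.sum_ite_eq]
  split_ifs with hS
  · rfl
  · rcases Nat.eq_zero_or_pos S.card with h0 | h0
    · simp [Finset.card_eq_zero.1 h0, PowerSeries.coeff_one, hn]
    · refine coeff_prod_invSqGeomTail_eq_zero ?_
      simp only [Finset.mem_Icc, not_and, not_le] at hS
      exact hS h0

/-- The sum of all multiple zeta values of weight `2 * n` with even arguments, and `1` for
`n = 0`. -/
noncomputable def totalEvenMZVSum (n : ℕ) : ℝ :=
  if n = 0 then 1 else ∑ k ∈ Finset.Icc 1 n, evenMZVSum (2 * n) k

theorem tendsto_coeff_prod_invSqGeom (n : ℕ) :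
    Tendsto (fun N => PowerSeries.coeff n (∏ m ∈ Finset.range N, invSqGeom m)) atTop
      (𝓝 (totalEvenMZVSum n)) := by
  rcases eq_or_ne n 0 with rfl | hn
  · simp [totalEvenMZVSum, invSqGeom, map_prod]
  · rw [totalEvenMZVSum, if_neg hn]
    -- The `N`-th product expands over the powerset of `range N`, and these powersets exhaust all
    -- finite sets.
    have h := ((hasSum_coeff_prod_invSqGeomTail hn).comp tendsto_finset_powerset_atTop_atTop).comp
      tendsto_finset_range
    refine h.congr fun N => ?_
    simp only [Function.comp_apply, invSqGeom_eq_one_add, Finset.prod_one_add, map_sum]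

/-! ### Convergence and Euler's sine product -/

theorem hasSum_coeff_mul {p q : PowerSeries ℂ} {t a b : ℂ}
    (hp : HasSum (fun n => PowerSeries.coeff n p * t ^ n) a)
    (hq : HasSum (fun n => PowerSeries.coeff n q * t ^ n) b) :
    HasSum (fun n => PowerSeries.coeff n (p * q) * t ^ n) (a * b) := by
  have hp' := summable_norm_iff.2 hp.summable
  have hq' := summable_norm_iff.2 hq.summable
  have h := (summable_norm_sum_mul_antidiagonal_of_summable_norm hp' hq').of_norm.hasSum
  rw [← tsum_mul_tsum_eq_tsum_sum_antidiagonal_of_summable_norm hp' hq', hp.tsum_eq,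
    hq.tsum_eq] at h
  refine h.congr_fun fun n => ?_
  rw [PowerSeries.coeff_mul, Finset.sum_mul]
  refine Finset.sum_congr rfl fun x hx => ?_
  rw [← Finset.HasAntidiagonal.mem_antidiagonal.1 hx, pow_add]
  ring

theorem eq_of_hasSum_coeff {p q : PowerSeries ℂ} {f : ℂ → ℂ}
    (hp : ∀ᶠ t in 𝓝 0, HasSum (fun n => PowerSeries.coeff n p * t ^ n) (f t))
    (hq : ∀ᶠ t in 𝓝 0, HasSum (fun n => PowerSeries.coeff n q * t ^ n) (f t)) : p = q := by
  have key {p : PowerSeries ℂ}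
      (hp : ∀ᶠ t in 𝓝 0, HasSum (fun n => PowerSeries.coeff n p * t ^ n) (f t)) :
      HasFPowerSeriesAt f (FormalMultilinearSeries.ofScalars ℂ fun n => PowerSeries.coeff n p)
        0 := by
    rw [hasFPowerSeriesAt_iff]
    filter_upwards [hp] with t ht
    simpa [FormalMultilinearSeries.coeff_ofScalars, mul_comm] using ht
  have h := (key hp).eq_formalMultilinearSeries (key hq)
  ext n
  simpa [FormalMultilinearSeries.coeff_ofScalars] using
    congrArg (fun s => FormalMultilinearSeries.coeff s n) h

theorem one_sub_div_natCast_sq_ne_zero {t : ℂ} (ht : ‖t‖ < 1) (m : ℕ) :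
    1 - t / (m : ℂ) ^ 2 ≠ 0 := by
  intro h
  have h1 : ‖t / (m : ℂ) ^ 2‖ = 1 := by rw [← sub_eq_zero.1 h, norm_one]
  rcases Nat.eq_zero_or_pos m with rfl | hm
  · simp at h1
  · have : (1 : ℝ) ≤ (m : ℝ) ^ 2 := one_le_pow₀ (by exact_mod_cast hm)
    rw [norm_div, norm_pow, Complex.norm_natCast] at h1
    have h2 := div_le_self (norm_nonneg t) this
    linarith

theorem hasSum_coeff_prod_invSqGeom {t : ℂ} (ht : ‖t‖ < 1) (N : ℕ) :
    HasSum (fun n => ((PowerSeries.coeff n (∏ m ∈ Finset.range N, invSqGeom m) : ℝ) : ℂ) * t ^ n)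
      (∏ m ∈ Finset.range N, (1 - t / (m : ℂ) ^ 2))⁻¹ := by
  have hmap (p : PowerSeries ℝ) (n : ℕ) : ((PowerSeries.coeff n p : ℝ) : ℂ) =
      PowerSeries.coeff n (PowerSeries.map Complex.ofRealHom p) := by simp
  simp only [hmap, map_prod]
  induction N with
  | zero =>
    convert hasSum_ite_eq 0 (1 : ℂ) using 2 with n
    · rcases eq_or_ne n 0 with rfl | hn <;> simp [PowerSeries.coeff_one, *]
    · simp
  | succ N ih =>
    rw [Finset.prod_range_succ, Finset.prod_range_succ, mul_inv]
    refine hasSum_coeff_mul ih ?_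
    have hlt : ‖t / (N : ℂ) ^ 2‖ < 1 := by
      rcases Nat.eq_zero_or_pos N with rfl | hN
      · simp
      · have : (1 : ℝ) ≤ (N : ℝ) ^ 2 := one_le_pow₀ (by exact_mod_cast hN)
        rw [norm_div, norm_pow, Complex.norm_natCast]
        exact (div_le_self (norm_nonneg t) this).trans_lt ht
    refine (hasSum_geometric_of_norm_lt_one hlt).congr_fun fun n => ?_
    simp [invSqGeom, div_eq_inv_mul, mul_pow]

theorem tendsto_prod_one_sub_div_natCast_sq {z : ℂ} (hz : z ≠ 0) :
    Tendsto (fun N => ∏ m ∈ Finset.range N, (1 - z ^ 2 / (m : ℂ) ^ 2)) atTop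
      (𝓝 (Complex.sin (Real.pi * z) / (Real.pi * z))) := by
  have hpi : (Real.pi : ℂ) * z ≠ 0 := mul_ne_zero (by exact_mod_cast Real.pi_ne_zero) hz
  rw [← tendsto_add_atTop_iff_nat 1]
  refine ((Complex.tendsto_euler_sin_prod z).div_const (Real.pi * z)).congr fun N => ?_
  rw [mul_div_cancel_left₀ _ hpi, Finset.prod_range_succ']
  simp

theorem coeff_prod_invSqGeom_nonneg (n N : ℕ) :
    0 ≤ PowerSeries.coeff n (∏ m ∈ Finset.range N, invSqGeom m) := by
  rw [PowerSeries.coeff_prod]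
  refine Finset.sum_nonneg fun l _ => Finset.prod_nonneg fun m _ => ?_
  rw [invSqGeom, PowerSeries.coeff_mk]
  positivity

/-- Coefficients are nonnegative, so each term at `t = 1/4` is at most the full sum there; these
sums converge to `π/2` as `N` grows, hence are bounded. -/
theorem exists_coeff_prod_invSqGeom_le : ∃ C : ℝ, ∀ n N : ℕ,
    PowerSeries.coeff n (∏ m ∈ Finset.range N, invSqGeom m) ≤ C * 4 ^ n := by
  have ht : ‖((1 / 2 : ℂ)) ^ 2‖ < 1 := by norm_num
  have hlim := (tendsto_prod_one_sub_div_natCast_sq (z := 1 / 2) (by norm_num)).inv₀ (by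
    have : (Real.pi : ℂ) * (1 / 2) = ((Real.pi / 2 : ℝ) : ℂ) := by push_cast; ring
    rw [this, ← Complex.ofReal_sin, Real.sin_pi_div_two]
    simp [Real.pi_ne_zero])
  obtain ⟨C, hC⟩ := (Metric.isBounded_range_of_tendsto _ hlim).exists_norm_le
  refine ⟨C, fun n N => ?_⟩
  have hs := Complex.hasSum_re (hasSum_coeff_prod_invSqGeom ht N)
  have hterm (n : ℕ) : (((PowerSeries.coeff n (∏ m ∈ Finset.range N, invSqGeom m) : ℝ) : ℂ) *
      ((1 / 2 : ℂ) ^ 2) ^ n).re =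
        PowerSeries.coeff n (∏ m ∈ Finset.range N, invSqGeom m) * (1 / 4) ^ n := by
    have : ((1 / 2 : ℂ) ^ 2) ^ n = (((1 / 4 : ℝ) ^ n : ℝ) : ℂ) := by push_cast; norm_num
    rw [this, ← Complex.ofReal_mul, Complex.ofReal_re]
  simp only [hterm] at hs
  have h1 := le_hasSum hs n fun j _ => mul_nonneg (coeff_prod_invSqGeom_nonneg j N) (by positivity)
  have h2 := h1.trans ((Complex.re_le_norm _).trans (hC _ ⟨N, rfl⟩))
  rw [one_div, inv_pow, ← div_eq_mul_inv] at h2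
  exact (div_le_iff₀ (by positivity)).1 h2

/-- The generating function of the sums of multiple zeta values with even arguments is inverse to
the Euler product of the sine. -/
theorem exists_hasSum_totalEvenMZVSum {t L : ℂ} (ht : ‖t‖ < 1 / 4)
    (hL : Tendsto (fun N => ∏ m ∈ Finset.range N, (1 - t / (m : ℂ) ^ 2)) atTop (𝓝 L)) :
    ∃ F, HasSum (fun n => (totalEvenMZVSum n : ℂ) * t ^ n) F ∧ F * L = 1 := by
  obtain ⟨C, hC⟩ := exists_coeff_prod_invSqGeom_le
  have ht1 : ‖t‖ < 1 := by linarith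
  have hsum : Summable fun n : ℕ => C * (4 * ‖t‖) ^ n :=
    (summable_geometric_of_lt_one (by positivity) (by linarith)).mul_left C
  have hbound (n N : ℕ) :
      ‖((PowerSeries.coeff n (∏ m ∈ Finset.range N, invSqGeom m) : ℝ) : ℂ) * t ^ n‖ ≤
        C * (4 * ‖t‖) ^ n := by
    rw [norm_mul, Complex.norm_real, Real.norm_of_nonneg (coeff_prod_invSqGeom_nonneg n N),
      norm_pow, mul_pow, ← mul_assoc]
    gcongr
    exact hC n N
  have hlim (n : ℕ) : Tendsto
      (fun N => ((PowerSeries.coeff n (∏ m ∈ Finset.range N, invSqGeom m) : ℝ) : ℂ) * t ^ n)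
      atTop (𝓝 ((totalEvenMZVSum n : ℂ) * t ^ n)) :=
    ((Complex.continuous_ofReal.tendsto _).comp (tendsto_coeff_prod_invSqGeom n)).mul_const _
  have hmain := tendsto_tsum_of_dominated_convergence hsum hlim
    (Eventually.of_forall fun N n => hbound n N)
  simp only [(hasSum_coeff_prod_invSqGeom ht1 _).tsum_eq] at hmain
  -- Passing to the limit in `P⁻¹ * P = 1` also yields `L ≠ 0`, that is, nonvanishing of the sine.
  have hmul := hmain.mul hL
  have hone : ∀ N : ℕ, (∏ m ∈ Finset.range N, (1 - t / (m : ℂ) ^ 2))⁻¹ *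
      ∏ m ∈ Finset.range N, (1 - t / (m : ℂ) ^ 2) = 1 := fun N =>
    inv_mul_cancel₀ (Finset.prod_ne_zero_iff.2 fun m _ => one_sub_div_natCast_sq_ne_zero ht1 m)
  simp only [hone] at hmul
  exact ⟨_, (Summable.of_norm_bounded hsum fun n =>
    le_of_tendsto (hlim n).norm (Eventually.of_forall (hbound n))).hasSum,
    tendsto_nhds_unique hmul tendsto_const_nhds⟩

theorem hasSum_totalEvenMZVSum_sq {z : ℂ} (hz : z ≠ 0) (hz2 : ‖z ^ 2‖ < 1 / 4) :
    Complex.sin (Real.pi * z) ≠ 0 ∧ HasSum (fun n => (totalEvenMZVSum n : ℂ) * (z ^ 2) ^ n)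
      (Real.pi * z / Complex.sin (Real.pi * z)) := by
  obtain ⟨F, hF, h⟩ :=
    exists_hasSum_totalEvenMZVSum hz2 (tendsto_prod_one_sub_div_natCast_sq hz)
  refine ⟨fun h0 => by simp [h0] at h, ?_⟩
  rwa [← inv_div, ← eq_inv_of_mul_eq_one_left h]

theorem hasSum_totalEvenMZVSum {t : ℂ} (ht : ‖t‖ < 1 / 4) :
    HasSum (fun n => (totalEvenMZVSum n : ℂ) * t ^ n) (piSqrtDivSin t) := by
  rcases eq_or_ne t 0 with rfl | h0
  · obtain ⟨F, hF, h⟩ := exists_hasSum_totalEvenMZVSum (t := 0) (L := 1) ht (by simp)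
    rw [mul_one] at h
    simpa [piSqrtDivSin, h] using hF
  · have hsq : (t ^ (1 / 2 : ℂ)) ^ 2 = t := by
      rw [one_div]
      exact_mod_cast Complex.cpow_nat_inv_pow t two_ne_zero
    rw [piSqrtDivSin, if_neg h0]
    have := (hasSum_totalEvenMZVSum_sq (z := t ^ (1 / 2 : ℂ))
      (fun h => h0 (by rw [← hsq, h]; simp)) (by rwa [hsq])).2
    rwa [hsq] at this

/-! ### Bernoulli numbers and the closed form -/

/-- The Bernoulli expansion of `2X / (eˣ - e⁻ˣ)`. -/
theorem bernoulliPowerSeries_mul_exp_sub_exp_neg :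
    (2 * bernoulliPowerSeries ℂ - PowerSeries.rescale 2 (bernoulliPowerSeries ℂ)) *
      (PowerSeries.exp ℂ - PowerSeries.evalNegHom (PowerSeries.exp ℂ)) = 2 * PowerSeries.X := by
  have h1 := bernoulliPowerSeries_mul_exp_sub_one ℂ
  have h2 := congrArg (PowerSeries.rescale (2 : ℂ)) h1
  have h4 := PowerSeries.exp_pow_eq_rescale_exp (A := ℂ) 2
  have h3 := PowerSeries.exp_mul_exp_neg_eq_one (A := ℂ)
  rw [Nat.cast_ofNat] at h4
  rw [map_mul, map_sub, map_one, ← h4, PowerSeries.rescale_X, map_ofNat] at h2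
  set E := PowerSeries.exp ℂ
  set E' := PowerSeries.evalNegHom E
  set B := bernoulliPowerSeries ℂ
  set B2 := PowerSeries.rescale (2 : ℂ) B
  -- Formally `2X/(E-1) - 2X/(E²-1) = 2XE/(E²-1)`, with `E * E' = 1`.
  linear_combination 2 * E' * (E + 1) * h1 - E' * h2 + (2 * PowerSeries.X - (2 * B - B2) * E) * h3

theorem hasSum_coeff_rescale_exp (a z : ℂ) :
    HasSum (fun n => PowerSeries.coeff n (PowerSeries.rescale a (PowerSeries.exp ℂ)) * z ^ n)
      (Complex.exp (a * z)) := by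
  rw [Complex.exp_eq_exp_ℂ]
  refine (NormedSpace.exp_series_hasSum_exp' (𝕂 := ℂ) (a * z)).congr_fun fun n => ?_
  simp [PowerSeries.coeff_rescale, mul_pow]
  ring

/-- The generating function in `X ^ 2` of the sums of multiple zeta values with even arguments. -/
noncomputable def evenMZVSeries : PowerSeries ℂ :=
  PowerSeries.mk fun m => if Even m then (totalEvenMZVSum (m / 2) : ℂ) else 0

theorem hasSum_coeff_evenMZVSeries {z a : ℂ}
    (h : HasSum (fun n => (totalEvenMZVSum n : ℂ) * (z ^ 2) ^ n) a) :
    HasSum (fun m => PowerSeries.coeff m evenMZVSeries * z ^ m) a := by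
  refine ((mul_right_injective₀ (two_ne_zero' ℕ)).hasSum_iff fun m hm => ?_).1 ?_
  · have : ¬ Even m := fun he => hm ⟨m / 2, Nat.mul_div_cancel' he.two_dvd⟩
    simp [evenMZVSeries, this]
  · refine h.congr_fun fun n => ?_
    simp [evenMZVSeries, pow_mul]

/-- Near `0` both sides sum to `2πiz`, because `(πz / sin πz) * (2i sin πz) = 2πiz`; uniqueness of
power series concludes. -/
theorem evenMZVSeries_mul_exp_sub_exp_neg :
    evenMZVSeries * PowerSeries.rescale (Real.pi * Complex.I)
      (PowerSeries.exp ℂ - PowerSeries.evalNegHom (PowerSeries.exp ℂ)) =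
        PowerSeries.rescale (Real.pi * Complex.I) (2 * PowerSeries.X) := by
  have hexp (z : ℂ) : HasSum (fun n => PowerSeries.coeff n
      (PowerSeries.rescale (Real.pi * Complex.I)
        (PowerSeries.exp ℂ - PowerSeries.evalNegHom (PowerSeries.exp ℂ))) * z ^ n)
      (2 * Complex.I * Complex.sin (Real.pi * z)) := by
    have h := (hasSum_coeff_rescale_exp (Real.pi * Complex.I) z).sub
      (hasSum_coeff_rescale_exp (-(Real.pi * Complex.I)) z)
    have hsin : 2 * Complex.I * Complex.sin (Real.pi * z) =
        Complex.exp (Real.pi * Complex.I * z) - Complex.exp (-(Real.pi * Complex.I) * z) := by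
      rw [Complex.sin]
      ring_nf
      rw [Complex.I_sq]
      ring
    rw [hsin]
    refine h.congr_fun fun n => ?_
    simp only [PowerSeries.evalNegHom, map_sub, PowerSeries.coeff_rescale, neg_pow (_ * _) n]
    ring
  refine eq_of_hasSum_coeff (f := fun z => 2 * Real.pi * Complex.I * z) ?_ ?_
  · filter_upwards [Metric.ball_mem_nhds (0 : ℂ) (by norm_num : (0 : ℝ) < 1 / 2)] with z hz
    have hz' : ‖z ^ 2‖ < 1 / 4 := by
      rw [mem_ball_zero_iff] at hz
      rw [norm_pow]
      nlinarith [norm_nonneg z]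
    rcases eq_or_ne z 0 with rfl | h0
    · have := hasSum_coeff_mul (hasSum_coeff_evenMZVSeries (hasSum_totalEvenMZVSum hz')) (hexp 0)
      simpa using this
    · obtain ⟨hs, hF⟩ := hasSum_totalEvenMZVSum_sq h0 hz'
      convert hasSum_coeff_mul (hasSum_coeff_evenMZVSeries hF) (hexp z) using 1
      field_simp
  · refine Eventually.of_forall fun z => ?_
    have hX : PowerSeries.rescale (Real.pi * Complex.I) (2 * PowerSeries.X) =
        PowerSeries.C (2 * Real.pi * Complex.I) * PowerSeries.X := by
      rw [map_mul, map_ofNat, PowerSeries.rescale_X]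
      simp only [map_mul, map_ofNat]
      ring
    rw [hX]
    convert hasSum_ite_eq 1 (2 * Real.pi * Complex.I * z) using 2 with n
    rw [PowerSeries.coeff_C_mul, PowerSeries.coeff_X]
    split_ifs with hn <;> simp [*]

theorem evenMZVSeries_eq :
    evenMZVSeries = PowerSeries.rescale (Real.pi * Complex.I)
      (2 * bernoulliPowerSeries ℂ - PowerSeries.rescale 2 (bernoulliPowerSeries ℂ)) := by
  have h := congrArg (PowerSeries.rescale ((Real.pi : ℂ) * Complex.I))
    bernoulliPowerSeries_mul_exp_sub_exp_neg
  rw [map_mul] at h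
  -- Were the cancelled factor zero, `2πiX` would vanish.
  refine mul_right_cancel₀ (fun h0 => ?_) (evenMZVSeries_mul_exp_sub_exp_neg.trans h.symm)
  rw [h0, mul_zero] at h
  have := congrArg (PowerSeries.coeff 1) h
  rw [← map_ofNat (PowerSeries.C (R := ℂ)) 2, PowerSeries.coeff_rescale,
    PowerSeries.coeff_C_mul] at this
  simp [Real.pi_ne_zero] at this

theorem totalEvenMZVSum_eq {n : ℕ} (hn : 1 ≤ n) :
    totalEvenMZVSum n =
      2 * ((2 : ℝ) ^ (2 * n - 1) - 1) * (-1 : ℝ) ^ (n - 1) * (bernoulli (2 * n) : ℝ) *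
        Real.pi ^ (2 * n) / ((2 * n)! : ℝ) := by
  have h := congrArg (PowerSeries.coeff (2 * n)) evenMZVSeries_eq
  rw [← map_ofNat (PowerSeries.C (R := ℂ)) 2] at h
  -- The sign `(-1)^(n-1)` combines `(πi)^(2n) = (-1)^n π^(2n)` with `2 - 2^(2n) = -2(2^(2n-1) -
  -- 1)`.
  simp only [evenMZVSeries, PowerSeries.coeff_mk, even_two_mul, if_true, PowerSeries.coeff_rescale,
    map_sub, PowerSeries.coeff_C_mul, bernoulliPowerSeries, mul_pow, pow_mul Complex.I,
    Complex.I_sq, mul_div_cancel_left₀ n two_ne_zero] at h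
  obtain ⟨m, rfl⟩ := Nat.exists_eq_add_of_le' hn
  apply Complex.ofReal_injective
  rw [h]
  have h2 : 2 * (m + 1) - 1 = 2 * m + 1 := by omega
  simp only [h2, Nat.add_sub_cancel, eq_ratCast]
  push_cast
  ring

theorem mainTheorem5 :
    (∀ n k : ℕ, 1 ≤ k → k ≤ n → ∀ i ∈ evenArguments (2 * n) k, Summable (mzvTerm i)) ∧
    (∀ n : ℕ, 1 ≤ n →
      ∑ k ∈ Finset.Icc 1 n, evenMZVSum (2 * n) k =
        2 * ((2 : ℝ) ^ (2 * n - 1) - 1) * (-1 : ℝ) ^ (n - 1) * (bernoulli (2 * n) : ℝ) *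
          Real.pi ^ (2 * n) / ((2 * n)! : ℝ)) ∧
    HasFPowerSeriesAt piSqrtDivSin
      (FormalMultilinearSeries.ofScalars ℂ fun n : ℕ =>
        if n = 0 then (1 : ℂ)
        else ((∑ k ∈ Finset.Icc 1 n, evenMZVSum (2 * n) k : ℝ) : ℂ)) 0 := by
  refine ⟨fun n k _ _ i hi => summable_mzvTerm hi, fun n hn => ?_, ?_⟩
  · rw [← totalEvenMZVSum_eq hn, totalEvenMZVSum, if_neg (by omega)]
  · rw [hasFPowerSeriesAt_iff]
    filter_upwards [Metric.ball_mem_nhds (0 : ℂ) (by norm_num : (0 : ℝ) < 1 / 4)] with t ht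
    rw [zero_add]
    refine (hasSum_totalEvenMZVSum (mem_ball_zero_iff.1 ht)).congr_fun fun n => ?_
    rw [FormalMultilinearSeries.coeff_ofScalars, totalEvenMZVSum, smul_eq_mul, mul_comm]
    split_ifs <;> simp
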